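/- Let $X$ be a complex Banach space and let $T$ be a bounded linear operator on $X$. An operator $S$ on a Banach space $Y$ is called upper semi-Fredholm if its range $\mathcal R(S)$ is closed and $\dim\mathcal N(S)<\infty$, where $\mathcal N(S)$ is its kernel; lower semi-Fredholm if $\operatorname{codim}\mathcal R(S)<\infty$; and semi-Fredholm if it is one or the other, in which case $\operatorname{ind}(S)=\dim\mathcal N(S)-\operatorname{codim}\mathcal R(S)\in\mathbb Z\cup\{-\infty,+\infty\}$ (dimensions taken in $\{0,1,2,\dots,\infty\}$). $S$ is called quasi-nilpotent if its spectrum contains no nonzero number. For a closed subspace $M$ of $X$ with $T(M)\subseteq M$, let $T_M\colon M\to M$ be the restriction of $T$. (1) Let $M,N,M',N'$ be closed $T$-invariant subspaces of $X$ with $M\cap N=\{0\}$ and $M'\cap N'=\{0\}$ such that $M\oplus N=M'\oplus N'$ is a closed subspace of $X$ (for instance $X$ itself). If $T_M$ and $T_{M'}$ are semi-Fredholm and $T_N$ and $T_{N'}$ are quasi-nilpotent, then $\operatorname{ind}(T_M)=\operatorname{ind}(T_{M'})$. (2) Call $T$ pseudo semi-B-Fredholm if there are closed $T$-invariant subspaces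 $M,N$ with $X=M\oplus N$, $T_M$ upper semi-Fredholm or lower semi-Fredholm, and $T_N$ quasi-nilpotent. For such $T$, the index $\operatorname{ind}(T):=\operatorname{ind}(T_M)$, computed from any decomposition $X=M\oplus N$ into closed $T$-invariant subspaces with $T_M$ semi-Fredholm and $T_N$ quasi-nilpotent, is well defined: there is exactly one value in $\mathbb Z\cup\{-\infty,+\infty\}$ arising as $\operatorname{ind}(T_M)$ from such decompositions, and every such decomposition gives this value. -/

import Mathlib

namespace PseudoSemiBFredholm

open scoped ENNReal

section Operators

variable {Y : Type*} [NormedAddCommGroup Y] [NormedSpace ℂ Y]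

/-- `S` is upper semi-Fredholm: closed range and finite-dimensional kernel. -/
def IsUpperSemiFredholm (S : Y →L[ℂ] Y) : Prop :=
  IsClosed (S.range : Set Y) ∧ FiniteDimensional ℂ S.ker

/-- `S` is lower semi-Fredholm: the range has finite codimension. -/
def IsLowerSemiFredholm (S : Y →L[ℂ] Y) : Prop :=
  FiniteDimensional ℂ (Y ⧸ S.range)

/-- `S` is semi-Fredholm: upper or lower semi-Fredholm. -/
def IsSemiFredholm (S : Y →L[ℂ] Y) : Prop :=
  IsUpperSemiFredholm S ∨ IsLowerSemiFredholm S

/-- The nullity `dim ker S`, in `{0, 1, 2, …, ∞}`. -/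
noncomputable def nullity (S : Y →L[ℂ] Y) : ℕ∞ :=
  Cardinal.toENat (Module.rank ℂ S.ker)

/-- The deficiency `codim (range S)`, in `{0, 1, 2, …, ∞}`. -/
noncomputable def deficiency (S : Y →L[ℂ] Y) : ℕ∞ :=
  Cardinal.toENat (Module.rank ℂ (Y ⧸ S.range))

/-- The index `dim ker S - codim (range S)`, an extended number. For semi-Fredholm `S` at most one
of the two terms is infinite, so that this is an integer, `⊤` or `⊥`. -/
noncomputable def index (S : Y →L[ℂ] Y) : EReal :=
  (((nullity S : ℕ∞) : ℝ≥0∞) : EReal) - (((deficiency S : ℕ∞) : ℝ≥0∞) : EReal)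

/-- `S` is quasi-nilpotent: no nonzero complex number lies in its spectrum. (The inclusion rather
than equality admits the operator on the zero space, whose spectrum is empty.) -/
def IsQuasinilpotent (S : Y →L[ℂ] Y) : Prop :=
  spectrum ℂ S ⊆ {0}

end Operators

section Decompositions

variable {X : Type*} [NormedAddCommGroup X] [NormedSpace ℂ X]

/-- `M` is a closed `T`-invariant subspace. -/
structure IsClosedInvariant (T : X →L[ℂ] X) (M : Submodule ℂ X) : Prop where
  isClosed : IsClosed (M : Set X)
  mapsTo : ∀ x ∈ M, T x ∈ M

/-- The restriction `T_M : M → M` of `T` to a closed invariant subspace `M`. -/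
noncomputable def restr (T : X →L[ℂ] X) {M : Submodule ℂ X} (hM : IsClosedInvariant T M) :
    M →L[ℂ] M :=
  T.restrict hM.mapsTo

/-- `(M, N)` completely reduces `T`: closed `T`-invariant subspaces with `X = M ⊕ N`. -/
structure Reduces (T : X →L[ℂ] X) (M N : Submodule ℂ X) : Prop where
  left : IsClosedInvariant T M
  right : IsClosedInvariant T N
  isCompl : IsCompl M N

/-- `T` is upper pseudo semi-B-Fredholm. -/
def IsUpperPseudoSemiBFredholm (T : X →L[ℂ] X) : Prop :=
  ∃ (M N : Submodule ℂ X) (h : Reduces T M N),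
    IsUpperSemiFredholm (restr T h.left) ∧ IsQuasinilpotent (restr T h.right)

/-- `T` is lower pseudo semi-B-Fredholm. -/
def IsLowerPseudoSemiBFredholm (T : X →L[ℂ] X) : Prop :=
  ∃ (M N : Submodule ℂ X) (h : Reduces T M N),
    IsLowerSemiFredholm (restr T h.left) ∧ IsQuasinilpotent (restr T h.right)

/-- `T` is pseudo semi-B-Fredholm: upper or lower pseudo semi-B-Fredholm. -/
def IsPseudoSemiBFredholm (T : X →L[ℂ] X) : Prop :=
  IsUpperPseudoSemiBFredholm T ∨ IsLowerPseudoSemiBFredholm T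

/-- `κ` is a value of the index of `T`: it is the index of `T_M` for some reducing pair `(M, N)`
with `T_M` semi-Fredholm and `T_N` quasi-nilpotent. -/
def IsIndexValue (T : X →L[ℂ] X) (κ : EReal) : Prop :=
  ∃ (M N : Submodule ℂ X) (h : Reduces T M N),
    IsSemiFredholm (restr T h.left) ∧ IsQuasinilpotent (restr T h.right) ∧
      index (restr T h.left) = κ

theorem IsPseudoSemiBFredholm.exists_isIndexValue {T : X →L[ℂ] X}
    (hT : IsPseudoSemiBFredholm T) : ∃ κ, IsIndexValue T κ := by
  rcases hT with ⟨M, N, h, hM, hN⟩ | ⟨M, N, h, hM, hN⟩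
  · exact ⟨_, M, N, h, Or.inl hM, hN, rfl⟩
  · exact ⟨_, M, N, h, Or.inr hM, hN, rfl⟩

/-- The index of a pseudo semi-B-Fredholm operator, computed from some chosen reducing pair. -/
noncomputable def pseudoIndex (T : X →L[ℂ] X) (hT : IsPseudoSemiBFredholm T) : EReal :=
  hT.exists_isIndexValue.choose

end Decompositions

end PseudoSemiBFredholm

/-!
The index of `T_M` does not depend on the decomposition because it can be read off from
`T - c` for a small nonzero scalar `c`, on the whole space `M ⊔ N`, where the decomposition is
no longer visible. Indeed `T_N - c` is bijective, as `T_N` is quasi-nilpotent, so the summand `N`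
contributes neither kernel nor cokernel (`index_restrict_eq_of_bijective`), while `T_M - c` has the
index of `T_M`, because the index of a semi-Fredholm operator is locally constant in operator norm
(`IsSemiFredholm.eventually_index_eq`). One `c` serves two decompositions at once
(`index_restr_eq_of_sup_eq`).

Local constancy has three cases. If kernel and cokernel of `S` are finite-dimensional, `S` restricts
to an isomorphism between a complement of the kernel and a complement of a finite-dimensional `F`.
Being an isomorphism is an open condition, and the index of any operator with this property is
determined by the two codimensions (`finrank_ker_add_finrank_quotient_map`). If only the kernel is
finite-dimensional, the cokernel has to stay infinite-dimensional
(`eventually_injective_and_infinite_coker`), and if only the cokernel is finite-dimensional, the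
kernel has to (`eventually_surjective_and_infinite_ker`). Both follow by compactness: an
infinite-dimensional space has bounded sequences with mutual distances at least `1`, and a small
perturbation would carry such a sequence into a finite-dimensional space with its terms still
separated.
-/

open Filter Topology
open scoped NNReal

namespace PseudoSemiBFredholm

/-! ### Nullity, deficiency and index -/

section Numbers

variable {Y : Type*} [NormedAddCommGroup Y] [NormedSpace ℂ Y]

theorem toENat_rank_eq_finrank (V : Type*) [AddCommGroup V] [Module ℂ V] [FiniteDimensional ℂ V] :
    Cardinal.toENat (Module.rank ℂ V) = (Module.finrank ℂ V : ℕ∞) := by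
  rw [← Module.finrank_eq_rank]; simp

theorem toENat_rank_eq_top {V : Type*} [AddCommGroup V] [Module ℂ V]
    (h : ¬ FiniteDimensional ℂ V) : Cardinal.toENat (Module.rank ℂ V) = ⊤ := by
  rw [Cardinal.toENat_eq_top, ← not_lt, Module.rank_lt_aleph0_iff]
  exact h

theorem index_of_finite (S : Y →L[ℂ] Y) [FiniteDimensional ℂ S.ker]
    [FiniteDimensional ℂ (Y ⧸ S.range)] :
    index S = (((Module.finrank ℂ S.ker : ℝ) - Module.finrank ℂ (Y ⧸ S.range) : ℝ) : EReal) := by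
  rw [index, nullity, deficiency, toENat_rank_eq_finrank, toENat_rank_eq_finrank]
  rfl

theorem index_of_infinite_coker (S : Y →L[ℂ] Y) [FiniteDimensional ℂ S.ker]
    (h : ¬ FiniteDimensional ℂ (Y ⧸ S.range)) : index S = ⊥ := by
  rw [index, nullity, deficiency, toENat_rank_eq_top h]
  simp

theorem index_of_infinite_ker (S : Y →L[ℂ] Y) [FiniteDimensional ℂ (Y ⧸ S.range)]
    (h : ¬ FiniteDimensional ℂ S.ker) : index S = ⊤ := by
  rw [index, nullity, deficiency, toENat_rank_eq_top h, toENat_rank_eq_finrank]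
  simp

end Numbers

/-! ### Kernels and cokernels of restricted linear maps -/

section Algebra

variable {V W : Type*} [AddCommGroup V] [Module ℂ V] [AddCommGroup W] [Module ℂ W]

theorem finiteDimensional_ker_of_disjoint (D : V →ₗ[ℂ] W) (Z : Submodule ℂ V)
    [FiniteDimensional ℂ (V ⧸ Z)] (h : Disjoint Z (LinearMap.ker D)) :
    FiniteDimensional ℂ (LinearMap.ker D) := by
  refine FiniteDimensional.of_injective (Z.mkQ ∘ₗ (LinearMap.ker D).subtype) ?_
  rw [← LinearMap.ker_eq_bot, LinearMap.ker_comp, Submodule.ker_mkQ,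
    ← Submodule.disjoint_iff_comap_eq_bot]
  exact h.symm

theorem finiteDimensional_quotient_of_le {P Q : Submodule ℂ W} (h : P ≤ Q)
    [FiniteDimensional ℂ (W ⧸ P)] : FiniteDimensional ℂ (W ⧸ Q) :=
  FiniteDimensional.of_surjective (Submodule.factor h) (Submodule.factor_surjective h)

/-- Restricting a linear map to a subspace of finite codimension that meets the kernel trivially
lowers its index by that codimension. -/
theorem finrank_ker_add_finrank_quotient_map (D : V →ₗ[ℂ] W) (Z : Submodule ℂ V)
    [FiniteDimensional ℂ (V ⧸ Z)] (h : Disjoint Z (LinearMap.ker D))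
    [FiniteDimensional ℂ (W ⧸ Z.map D)] :
    Module.finrank ℂ (LinearMap.ker D) + Module.finrank ℂ (W ⧸ Z.map D) =
      Module.finrank ℂ (V ⧸ Z) + Module.finrank ℂ (W ⧸ LinearMap.range D) := by
  let B : V ⧸ Z →ₗ[ℂ] W ⧸ Z.map D := Z.mapQ (Z.map D) D (Submodule.le_comap_map D Z)
  have hB : B ∘ₗ Z.mkQ = (Z.map D).mkQ ∘ₗ D := Submodule.mapQ_mkQ _ _ _
  -- the quotient map sends the kernel of `D` isomorphically onto the kernel of `B`
  have hker : Module.finrank ℂ (LinearMap.ker B) = Module.finrank ℂ (LinearMap.ker D) := by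
    have hinj : Function.Injective (Z.mkQ ∘ₗ (LinearMap.ker D).subtype) := by
      rw [← LinearMap.ker_eq_bot, LinearMap.ker_comp, Submodule.ker_mkQ,
        ← Submodule.disjoint_iff_comap_eq_bot]
      exact h.symm
    rw [← LinearMap.finrank_range_of_inj hinj]
    have : LinearMap.ker B = LinearMap.range (Z.mkQ ∘ₗ (LinearMap.ker D).subtype) := by
      apply le_antisymm
      · intro q hq
        obtain ⟨v, rfl⟩ := Z.mkQ_surjective q
        have h1 : (Z.map D).mkQ (D v) = 0 := by
          rw [← LinearMap.comp_apply, ← hB]; exact hq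
        obtain ⟨z, hz, hzv⟩ := (Submodule.Quotient.mk_eq_zero _).1 h1
        refine ⟨⟨v - z, by simp [hzv]⟩, ?_⟩
        have : Z.mkQ z = 0 := (Submodule.Quotient.mk_eq_zero _).2 hz
        rw [LinearMap.comp_apply, Submodule.subtype_apply, map_sub, this, sub_zero]
      · rintro _ ⟨⟨v, hv⟩, rfl⟩
        rw [LinearMap.mem_ker, LinearMap.comp_apply, ← LinearMap.comp_apply B, hB]
        simp [LinearMap.mem_ker.1 hv]
    rw [this]
  have hrange : LinearMap.range B = (LinearMap.range D).map (Z.map D).mkQ := by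
    rw [← LinearMap.range_comp, ← hB, LinearMap.range_comp, Submodule.range_mkQ,
      Submodule.map_top]
  have hcoker : Module.finrank ℂ ((W ⧸ Z.map D) ⧸ LinearMap.range B) =
      Module.finrank ℂ (W ⧸ LinearMap.range D) := by
    rw [hrange]
    exact (Submodule.quotientQuotientEquivQuotient (Z.map D) (LinearMap.range D)
      (LinearMap.map_le_range)).finrank_eq
  have h1 := B.finrank_range_add_finrank_ker
  have h2 := (LinearMap.range B).finrank_quotient_add_finrank
  omega

/-- An injective intertwiner `i` from `f` to `g` that captures the kernel of `g`, is onto modulo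
the range of `g`, and pulls the range of `g` back into the range of `f`, identifies kernels and
cokernels. -/
theorem rank_eq_of_intertwining {f : V →ₗ[ℂ] V} {g : W →ₗ[ℂ] W} (i : V →ₗ[ℂ] W)
    (hi : Function.Injective i) (hcomm : ∀ v, g (i v) = i (f v))
    (hker : ∀ w, g w = 0 → ∃ v, i v = w) (hcod : ∀ w, ∃ v w', w = i v + g w')
    (hrange : ∀ v w, i v = g w → ∃ v', f v' = v) :
    Cardinal.toENat (Module.rank ℂ (LinearMap.ker f)) =
        Cardinal.toENat (Module.rank ℂ (LinearMap.ker g)) ∧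
      Cardinal.toENat (Module.rank ℂ (V ⧸ LinearMap.range f)) =
        Cardinal.toENat (Module.rank ℂ (W ⧸ LinearMap.range g)) := by
  have key : ∀ {P Q : Type _} [AddCommGroup P] [AddCommGroup Q] [Module ℂ P] [Module ℂ Q],
      (P ≃ₗ[ℂ] Q) → Cardinal.toENat (Module.rank ℂ P) = Cardinal.toENat (Module.rank ℂ Q) := by
    intro P Q _ _ _ _ e
    have := congrArg Cardinal.toENat e.lift_rank_eq
    simpa using this
  constructor
  · refine key (LinearEquiv.ofBijective
      (i.restrict (p := LinearMap.ker f) (q := LinearMap.ker g) ?_) ⟨?_, ?_⟩)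
    · intro v hv
      rw [LinearMap.mem_ker, hcomm, LinearMap.mem_ker.1 hv, map_zero]
    · intro a b hab
      exact Subtype.ext (hi (congrArg Subtype.val hab))
    · rintro ⟨w, hw⟩
      obtain ⟨v, rfl⟩ := hker w hw
      refine ⟨⟨v, ?_⟩, rfl⟩
      apply hi
      rw [← hcomm, map_zero]; exact hw
  · refine key (LinearEquiv.ofBijective
      ((LinearMap.range f).mapQ (LinearMap.range g) i ?_) ⟨?_, ?_⟩)
    · rintro _ ⟨v, rfl⟩
      exact ⟨i v, hcomm v⟩
    · rw [← LinearMap.ker_eq_bot, LinearMap.ker_eq_bot']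
      intro q hq
      obtain ⟨v, rfl⟩ := Submodule.mkQ_surjective _ q
      obtain ⟨w, hw⟩ := (Submodule.Quotient.mk_eq_zero _).1 hq
      exact (Submodule.Quotient.mk_eq_zero _).2 (hrange v w hw.symm)
    · intro q
      obtain ⟨w, rfl⟩ := Submodule.mkQ_surjective _ q
      obtain ⟨v, w', rfl⟩ := hcod w
      refine ⟨Submodule.Quotient.mk v, ?_⟩
      have hw' : (LinearMap.range g).mkQ (g w') = 0 :=
        (Submodule.Quotient.mk_eq_zero _).2 ⟨w', rfl⟩
      rw [map_add, hw', add_zero]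
      rfl

end Algebra

/-! ### Perturbation of infinite-dimensional kernels and cokernels -/

section Perturbation

theorem exists_ne_norm_sub_lt {V : Type*} [NormedAddCommGroup V] [NormedSpace ℂ V]
    [FiniteDimensional ℂ V] (v : ℕ → V) (R : ℝ) (hv : ∀ n, ‖v n‖ ≤ R) {ε : ℝ} (hε : 0 < ε) :
    ∃ i j, i ≠ j ∧ ‖v i - v j‖ < ε := by
  have : ProperSpace V := FiniteDimensional.proper ℂ V
  obtain ⟨a, -, φ, hφ, hlim⟩ := tendsto_subseq_of_bounded (Metric.isBounded_closedBall (x := 0))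
    (fun n => mem_closedBall_zero_iff.2 (hv n))
  obtain ⟨n, hn⟩ := Metric.cauchySeq_iff'.1 hlim.cauchySeq ε hε
  refine ⟨φ (n + 1), φ n, (hφ n.lt_succ_self).ne', ?_⟩
  rw [← dist_eq_norm]
  exact hn (n + 1) n.le_succ

variable {E Y : Type*} [NormedAddCommGroup E] [NormedSpace ℂ E] [CompleteSpace E]
  [NormedAddCommGroup Y] [NormedSpace ℂ Y]

/-- If an operator bounded below has infinite codimensional range, so do all nearby operators:
otherwise two of infinitely many bounded vectors, separated modulo the range of `J`, would nearly
agree modulo the range of `J'`, by a bounded correction `J' z`, which is close to `J z`. -/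
theorem eventually_injective_and_infinite_coker {J : E →L[ℂ] Y} {K : ℝ≥0}
    (hJ : AntilipschitzWith K J) (hinf : ¬ FiniteDimensional ℂ (Y ⧸ J.range)) :
    ∀ᶠ J' : E →L[ℂ] Y in 𝓝 J, Function.Injective J' ∧ ¬ FiniteDimensional ℂ (Y ⧸ J'.range) := by
  have hcl : IsClosed (J.range : Set Y) := hJ.isClosed_range J.uniformContinuous
  obtain ⟨R, q, hR, hq, hsep⟩ := exists_seq_norm_le_one_le_norm_sub (𝕜 := ℂ) hinf
  choose y hy hyn using fun n => Submodule.Quotient.norm_mk_lt (q n) one_pos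
  have hyR : ∀ n, ‖y n‖ ≤ R + 1 := fun n => (hyn n).le.trans (by linarith [hq n])
  -- `c` bounds the corrections `z` occurring below
  set c : ℝ := 2 * (K + 1) * (2 * (R + 1) + 1) with hc
  have hK : (0 : ℝ) ≤ K := K.2
  have hc0 : 2 * (K + 1) ≤ c := by rw [hc]; nlinarith
  have hcpos : 0 < c := by linarith
  filter_upwards [Metric.ball_mem_nhds J (show 0 < 1 / (2 * c) by positivity)] with J' hJ'
  rw [mem_ball_iff_norm] at hJ'
  have hdiff : ∀ z, ‖J' z - J z‖ ≤ 1 / (2 * c) * ‖z‖ := fun z =>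
    ((J' - J).le_opNorm z).trans (by gcongr)
  have hlow : ∀ z, ‖z‖ ≤ 2 * (K + 1) * ‖J' z‖ := by
    intro z
    have h1 : ‖z‖ ≤ K * ‖J z‖ := by simpa using hJ.le_mul_dist z 0
    have h2 : ‖J z‖ ≤ ‖J' z‖ + 1 / (2 * c) * ‖z‖ := by
      have := norm_sub_norm_le (J z) (J' z)
      rw [norm_sub_rev] at this
      linarith [hdiff z]
    have h3 : (K + 1) * (1 / (2 * c) * ‖z‖) ≤ 1 / 4 * ‖z‖ := by
      rw [← mul_assoc]
      gcongr
      rw [mul_one_div, div_le_iff₀ (by positivity)]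
      linarith
    nlinarith [norm_nonneg z, norm_nonneg (J z), norm_nonneg (J' z)]
  have hanti : AntilipschitzWith (2 * (K + 1)) J' :=
    J'.antilipschitz_of_bound (fun z => by simpa using hlow z)
  refine ⟨hanti.injective, fun hfin => ?_⟩
  have hcl' : IsClosed (J'.range : Set Y) := hanti.isClosed_range J'.uniformContinuous
  obtain ⟨i, j, hij, hlt⟩ := exists_ne_norm_sub_lt
    (fun n => (Submodule.Quotient.mk (y n) : Y ⧸ J'.range)) (R + 1)
    (fun n => (Submodule.Quotient.norm_mk_le _ _).trans (hyR n)) (show (0 : ℝ) < 1 / 4 by norm_num)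
  rw [← Submodule.Quotient.mk_sub] at hlt
  obtain ⟨w, hw, hwlt⟩ := Submodule.Quotient.norm_mk_lt
    (Submodule.Quotient.mk (y i - y j) : Y ⧸ J'.range)
    (show 0 < 1 / 4 - ‖(Submodule.Quotient.mk (y i - y j) : Y ⧸ J'.range)‖ by linarith)
  -- `w` is the small remainder, `J' z` the correction
  obtain ⟨z, hz⟩ : y i - y j - w ∈ J'.range :=
    (Submodule.Quotient.eq _).1 hw.symm
  have hwlt' : ‖w‖ < 1 / 4 := by linarith
  have hz' : J' z = y i - y j - w := hz
  have hJz : ‖J' z‖ ≤ 2 * (R + 1) + 1 := by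
    rw [hz']
    linarith [norm_sub_le (y i - y j) w, norm_sub_le (y i) (y j), hyR i, hyR j]
  have hzc : ‖z‖ ≤ c := (hlow z).trans (by rw [hc]; gcongr)
  have hfinal : ‖y i - y j - J z‖ < 1 := by
    have h1 : y i - y j - J z = w + (J' z - J z) := by rw [hz']; abel
    have h2 : 1 / (2 * c) * ‖z‖ ≤ 1 / 2 := by
      rw [one_div_mul_eq_div, div_le_iff₀ (by positivity)]; linarith
    rw [h1]
    linarith [norm_add_le w (J' z - J z), hdiff z]
  refine absurd (hsep hij) (not_le.2 (lt_of_le_of_lt ?_ hfinal))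
  rw [← hy i, ← hy j, ← Submodule.Quotient.mk_sub]
  refine le_of_eq_of_le (congrArg norm ?_) (Submodule.Quotient.norm_mk_le J.range _)
  exact (Submodule.Quotient.eq _).2 (by simp)

variable [CompleteSpace Y]

/-- Operators near a surjective one are surjective, with a uniform bound on preimages. -/
theorem exists_eventually_preimage_norm_le {G : E →L[ℂ] Y} (hG : Function.Surjective G) :
    ∃ C > 0, ∀ᶠ G' in 𝓝 G, ∀ y, ∃ x, G' x = y ∧ ‖x‖ ≤ C * ‖y‖ := by
  obtain ⟨C, hC, hpre⟩ := G.exists_preimage_norm_le hG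
  choose s hs hsn using hpre
  -- the factor `2` absorbs perturbations of norm below half of `C⁻¹`
  let r : G.NonlinearRightInverse := ⟨s, ⟨C, hC.le⟩, hsn, hs⟩
  refine ⟨2 * C, by positivity, ?_⟩
  filter_upwards [Metric.ball_mem_nhds G (show 0 < 1 / (2 * C) by positivity)] with G' hG' y
  rw [mem_ball_iff_norm] at hG'
  have happ : ApproximatesLinearOn G' G Set.univ ‖G' - G‖₊ := by
    intro a _ b _
    have := (G' - G).le_opNorm (a - b)
    simpa [map_sub, sub_sub_sub_comm] using this
  obtain ⟨x, hx, hxy⟩ := happ.surjOn_closedBall_of_nonlinearRightInverse r (b := 0)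
    (ε := 2 * C * ‖y‖) (by positivity) (Set.subset_univ _) (show y ∈ _ by
      rw [map_zero, mem_closedBall_zero_iff]
      have h1 : (1 / (2 * C)) ≤ C⁻¹ - ‖G' - G‖ := by
        have : C⁻¹ = 1 / (2 * C) + 1 / (2 * C) := by field_simp; norm_num
        linarith
      calc ‖y‖ = 1 / (2 * C) * (2 * C * ‖y‖) := by field_simp
        _ ≤ _ := by
          refine mul_le_mul_of_nonneg_right h1 (by positivity))
  exact ⟨x, hxy, mem_closedBall_zero_iff.1 hx⟩

/-- If a surjective operator has infinite dimensional kernel, so do all nearby operators: bounded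
separated vectors in the kernel of `G` can be moved a little into the kernel of `G'`, where they
stay separated. -/
theorem eventually_surjective_and_infinite_ker {G : E →L[ℂ] Y} (hG : Function.Surjective G)
    (hinf : ¬ FiniteDimensional ℂ G.ker) :
    ∀ᶠ G' : E →L[ℂ] Y in 𝓝 G, Function.Surjective G' ∧ ¬ FiniteDimensional ℂ G'.ker := by
  obtain ⟨C, hC, hev⟩ := exists_eventually_preimage_norm_le hG
  obtain ⟨R, x, hR, hx, hsep⟩ := exists_seq_norm_le_one_le_norm_sub (𝕜 := ℂ) hinf
  filter_upwards [hev, Metric.ball_mem_nhds G (show 0 < 1 / (4 * C * R) by positivity)]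
    with G' hpre hG'
  rw [mem_ball_iff_norm] at hG'
  refine ⟨fun y => (hpre y).imp fun _ h => h.1, fun hfin => ?_⟩
  -- `x n - w n` lies in the kernel of `G'`
  choose w hw hwn using fun n => hpre (G' (x n : E))
  have hsmall : ∀ n, ‖w n‖ ≤ 1 / 4 := by
    intro n
    have h0 : G (x n : E) = 0 := (x n).2
    have h1 : ‖G' (x n : E)‖ ≤ 1 / (4 * C * R) * R := by
      have := (G' - G).le_opNorm (x n : E)
      rw [sub_apply, h0, sub_zero] at this
      refine this.trans ?_
      gcongr
      exact hx n
    calc ‖w n‖ ≤ C * ‖G' (x n : E)‖ := hwn n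
      _ ≤ C * (1 / (4 * C * R) * R) := by gcongr
      _ = 1 / 4 := by field_simp
  obtain ⟨i, j, hij, hlt⟩ := exists_ne_norm_sub_lt
    (fun n => (⟨x n - w n, by simp [hw n]⟩ : G'.ker)) (R + 1 / 4)
    (fun n => (norm_sub_le (x n : E) (w n)).trans (add_le_add (hx n) (hsmall n)))
    (show (0 : ℝ) < 1 / 4 by norm_num)
  have hlt' : ‖((x i : E) - w i) - (x j - w j)‖ < 1 / 4 := hlt
  have hle : 1 ≤ ‖(x i : E) - x j‖ := hsep hij
  have heq : (x i : E) - x j = (((x i : E) - w i) - (x j - w j)) + (w i - w j) := by abel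
  rw [heq] at hle
  linarith [norm_add_le (((x i : E) - w i) - (x j - w j)) (w i - w j), norm_sub_le (w i) (w j),
    hsmall i, hsmall j]

end Perturbation

/-! ### Local constancy of the index -/

section Stability

variable {Y : Type*} [NormedAddCommGroup Y] [NormedSpace ℂ Y]

theorem domRestrict_range_eq_of_isCompl {S : Y →L[ℂ] Y} {Z : Submodule ℂ Y}
    (h : IsCompl S.ker Z) : (S.domRestrict Z).range = S.range := by
  apply le_antisymm
  · rintro _ ⟨z, rfl⟩
    exact ⟨z, rfl⟩
  · rintro _ ⟨y, rfl⟩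
    obtain ⟨k, hk, z, hz, rfl⟩ := Submodule.mem_sup.1
      (h.sup_eq_top.symm ▸ Submodule.mem_top : y ∈ S.ker ⊔ Z)
    have hk' : S k = 0 := hk
    exact ⟨⟨z, hz⟩, by simp [hk']⟩

theorem domRestrict_injective_iff {S : Y →L[ℂ] Y} {Z : Submodule ℂ Y} :
    Function.Injective (S.domRestrict Z) ↔ Disjoint Z S.ker := by
  rw [Submodule.disjoint_iff_comap_eq_bot, ← LinearMap.ker_domRestrict, LinearMap.ker_eq_bot]
  rfl

theorem domRestrict_range_eq_map (S : Y →L[ℂ] Y) (Z : Submodule ℂ Y) :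
    (S.domRestrict Z).range = Z.map (S : Y →ₗ[ℂ] Y) :=
  LinearMap.range_domRestrict _ _

theorem continuous_domRestrict (Z : Submodule ℂ Y) :
    Continuous (fun A : Y →L[ℂ] Y => A.domRestrict Z) :=
  (continuous_id.clm_comp continuous_const : Continuous fun A : Y →L[ℂ] Y => A.comp Z.subtypeL)

theorem continuous_coprod_subtypeL {E : Type*} [NormedAddCommGroup E] [NormedSpace ℂ E]
    (F : Submodule ℂ Y) : Continuous (fun A : E →L[ℂ] Y => A.coprod F.subtypeL) := by
  have : (fun A : E →L[ℂ] Y => A.coprod F.subtypeL) = fun A =>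
      A.comp (ContinuousLinearMap.fst ℂ E F) + F.subtypeL.comp (ContinuousLinearMap.snd ℂ E F) := by
    ext A x <;> simp
  rw [this]
  fun_prop

variable [CompleteSpace Y]

/-- Finite kernel and cokernel: with `Z` complementary to the kernel and `F` to the range, the map
`(z, f) ↦ S z + f` from `Z × F` is an isomorphism, and remains one for operators near `S`. -/
theorem eventually_index_eq_of_finite (S : Y →L[ℂ] Y) [FiniteDimensional ℂ S.ker]
    [FiniteDimensional ℂ (Y ⧸ S.range)] : ∀ᶠ A in 𝓝 S, index A = index S := by
  obtain ⟨Z, hZcl, hZ⟩ := (Submodule.ClosedComplemented.of_finiteDimensional S.ker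
    ).exists_isClosed_isCompl
  obtain ⟨F, hF⟩ := Submodule.exists_isCompl S.range
  have : CompleteSpace Z := hZcl.completeSpace_coe
  have : FiniteDimensional ℂ F := (Submodule.quotientEquivOfIsCompl _ _ hF).finiteDimensional
  have : FiniteDimensional ℂ (Y ⧸ Z) :=
    (Submodule.quotientEquivOfIsCompl _ _ hZ.symm).symm.finiteDimensional
  have : CompleteSpace F := FiniteDimensional.complete ℂ F
  have hSF : IsCompl (S.domRestrict Z).range F := by rwa [domRestrict_range_eq_of_isCompl hZ]
  have hSinj : (S.domRestrict Z).ker = ⊥ :=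
    LinearMap.ker_eq_bot.2 (domRestrict_injective_iff.2 hZ.disjoint.symm)
  let e := (S.domRestrict Z).coprodSubtypeLEquivOfIsCompl hSF hSinj
  -- the value of the index at any operator giving an isomorphism
  have hval : ∀ A : Y →L[ℂ] Y, IsCompl (A.domRestrict Z).range F →
      Function.Injective (A.domRestrict Z) → index A =
        (((Module.finrank ℂ (Y ⧸ Z) : ℝ) - Module.finrank ℂ F : ℝ) : EReal) := by
    intro A hA hAinj
    have hdisj := domRestrict_injective_iff.1 hAinj
    rw [domRestrict_range_eq_map] at hA
    let eF := Submodule.quotientEquivOfIsCompl _ _ hA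
    have : FiniteDimensional ℂ (Y ⧸ Z.map (A : Y →ₗ[ℂ] Y)) := eF.symm.finiteDimensional
    have : FiniteDimensional ℂ A.ker := finiteDimensional_ker_of_disjoint _ Z hdisj
    have : FiniteDimensional ℂ (Y ⧸ A.range) :=
      finiteDimensional_quotient_of_le (LinearMap.map_le_range (f := (A : Y →ₗ[ℂ] Y)) (p := Z))
    rw [index_of_finite]
    have h := finrank_ker_add_finrank_quotient_map (A : Y →ₗ[ℂ] Y) Z hdisj
    rw [eF.finrank_eq] at h
    congr 1
    have h' : (Module.finrank ℂ A.ker : ℝ) + Module.finrank ℂ F =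
      Module.finrank ℂ (Y ⧸ Z) + Module.finrank ℂ (Y ⧸ A.range) := by exact_mod_cast h
    linarith
  have hcont : Continuous fun A : Y →L[ℂ] Y => (A.domRestrict Z).coprod F.subtypeL :=
    (continuous_coprod_subtypeL F).comp (continuous_domRestrict Z)
  filter_upwards [hcont.continuousAt.preimage_mem_nhds (e.nhds)] with A ⟨e', he'⟩
  have happ : ∀ p : Z × F, e' p = A.domRestrict Z p.1 + p.2 := fun p => by
    rw [← ContinuousLinearEquiv.coe_coe, he']; rfl
  rw [hval S hSF (LinearMap.ker_eq_bot.1 hSinj), hval A ⟨?_, ?_⟩ ?_]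
  · rw [Submodule.disjoint_def]
    rintro _ ⟨z, rfl⟩ hz
    have : e' (z, -⟨_, hz⟩) = 0 := by simp [happ]
    have : z = 0 := congrArg Prod.fst (e'.map_eq_zero_iff.1 this)
    simp [this]
  · rw [codisjoint_iff, eq_top_iff]
    intro y _
    obtain ⟨p, rfl⟩ := e'.surjective y
    rw [happ]
    exact Submodule.add_mem_sup ⟨p.1, rfl⟩ p.2.2
  · intro a b hab
    have : e' (a, 0) = e' (b, 0) := by simp only [happ, hab]
    exact congrArg Prod.fst (e'.injective this)

/-- Infinite codimension: on a closed complement of the finite-dimensional kernel `S` is bounded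
below, so nearby operators still have infinite-dimensional cokernel there, and hence on `Y`. -/
theorem eventually_index_eq_bot {S : Y →L[ℂ] Y} (hcl : IsClosed (S.range : Set Y))
    [FiniteDimensional ℂ S.ker] (hinf : ¬ FiniteDimensional ℂ (Y ⧸ S.range)) :
    ∀ᶠ A in 𝓝 S, index A = ⊥ := by
  obtain ⟨Z, hZcl, hZ⟩ := (Submodule.ClosedComplemented.of_finiteDimensional S.ker
    ).exists_isClosed_isCompl
  have : CompleteSpace Z := hZcl.completeSpace_coe
  have : FiniteDimensional ℂ (Y ⧸ Z) :=
    (Submodule.quotientEquivOfIsCompl _ _ hZ.symm).symm.finiteDimensional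
  have hrange := domRestrict_range_eq_of_isCompl hZ
  obtain ⟨K, hK⟩ := (S.domRestrict Z).antilipschitz_of_injective_of_isClosed_range
    (domRestrict_injective_iff.2 hZ.disjoint.symm) (by
      rw [← hrange] at hcl; exact hcl)
  have hev := eventually_injective_and_infinite_coker hK (by rwa [hrange])
  filter_upwards [(continuous_domRestrict Z).continuousAt.eventually hev] with A ⟨hA, hAinf⟩
  have hdisj := domRestrict_injective_iff.1 hA
  have : FiniteDimensional ℂ A.ker := finiteDimensional_ker_of_disjoint _ Z hdisj
  refine index_of_infinite_coker A fun hfin => hAinf ?_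
  -- `A Z` has finite codimension in the range of `A`, since `Z` has in the whole space
  rw [domRestrict_range_eq_map]
  have : Module.Finite ℂ (LinearMap.range ((Z.map (A : Y →ₗ[ℂ] Y)).mkQ ∘ₗ (A : Y →ₗ[ℂ] Y))) := by
    have hle : Z ≤ LinearMap.ker ((Z.map (A : Y →ₗ[ℂ] Y)).mkQ ∘ₗ (A : Y →ₗ[ℂ] Y)) := by
      rw [LinearMap.ker_comp, Submodule.ker_mkQ]
      exact Submodule.le_comap_map _ _
    rw [← Submodule.range_liftQ Z _ hle]
    infer_instance
  rw [LinearMap.range_comp] at this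
  have : Module.Finite ℂ ((Y ⧸ Z.map (A : Y →ₗ[ℂ] Y)) ⧸
      (LinearMap.range (A : Y →ₗ[ℂ] Y)).map (Z.map (A : Y →ₗ[ℂ] Y)).mkQ) :=
    (Submodule.quotientQuotientEquivQuotient (Z.map (A : Y →ₗ[ℂ] Y)) (LinearMap.range
      (A : Y →ₗ[ℂ] Y)) LinearMap.map_le_range).symm.finiteDimensional
  exact Module.Finite.of_submodule_quotient
    ((LinearMap.range (A : Y →ₗ[ℂ] Y)).map (Z.map (A : Y →ₗ[ℂ] Y)).mkQ)

/-- Infinite nullity: adjoining a finite-dimensional complement of the range as a summand of the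
domain makes the operator onto, without affecting whether its kernel is infinite-dimensional. -/
theorem eventually_index_eq_top {S : Y →L[ℂ] Y} [FiniteDimensional ℂ (Y ⧸ S.range)]
    (hinf : ¬ FiniteDimensional ℂ S.ker) : ∀ᶠ A in 𝓝 S, index A = ⊤ := by
  obtain ⟨F, hF⟩ := Submodule.exists_isCompl S.range
  have : FiniteDimensional ℂ F := (Submodule.quotientEquivOfIsCompl _ _ hF).finiteDimensional
  have : CompleteSpace F := FiniteDimensional.complete ℂ F
  have hsurj : Function.Surjective (S.coprod F.subtypeL) := by
    refine LinearMap.range_eq_top.1 ?_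
    rw [ContinuousLinearMap.coe_coprod, LinearMap.range_coprod]
    simpa using hF.sup_eq_top
  have hker : ¬ FiniteDimensional ℂ (S.coprod F.subtypeL).ker := by
    intro hfin
    refine hinf (FiniteDimensional.of_injective ((LinearMap.inl ℂ Y F).restrict
      (p := S.ker) (q := (S.coprod F.subtypeL).ker) fun y hy => ?_) fun a b hab => ?_)
    · have : S y = 0 := hy
      simp [this]
    · exact Subtype.ext (congrArg (fun p : (S.coprod F.subtypeL).ker => (p : Y × F).1) hab)
  filter_upwards [(continuous_coprod_subtypeL F).continuousAt.eventually
    (eventually_surjective_and_infinite_ker hsurj hker)] with A ⟨hA, hAker⟩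
  have : FiniteDimensional ℂ (Y ⧸ A.range) := by
    refine FiniteDimensional.of_surjective (A.range.mkQ ∘ₗ F.subtype) fun q => ?_
    obtain ⟨y, rfl⟩ := A.range.mkQ_surjective q
    obtain ⟨p, rfl⟩ := hA y
    refine ⟨p.2, (Submodule.Quotient.eq _).2 ⟨-p.1, ?_⟩⟩
    simp
  refine index_of_infinite_ker A fun hfin => hAker ?_
  rw [← Submodule.fg_iff_finiteDimensional]
  refine Submodule.fg_of_fg_map_of_fg_inf_ker (LinearMap.snd ℂ Y F)
    (Submodule.fg_iff_finiteDimensional _ |>.2 inferInstance) ?_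
  refine Submodule.FG.of_le (((Submodule.fg_iff_finiteDimensional A.ker).2 hfin).map
    (LinearMap.inl ℂ Y F)) ?_
  rintro ⟨y, f⟩ ⟨h1, h2⟩
  obtain rfl : f = 0 := h2
  exact ⟨y, by simpa using h1, rfl⟩

/-- The index of a semi-Fredholm operator is locally constant. -/
theorem IsSemiFredholm.eventually_index_eq {S : Y →L[ℂ] Y} (hS : IsSemiFredholm S) :
    ∀ᶠ A in 𝓝 S, index A = index S := by
  by_cases hk : FiniteDimensional ℂ S.ker <;> by_cases hc : FiniteDimensional ℂ (Y ⧸ S.range)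
  · exact eventually_index_eq_of_finite S
  · have hcl : IsClosed (S.range : Set Y) := hS.elim (fun h => h.1) fun h => absurd h hc
    rw [index_of_infinite_coker S hc]
    exact eventually_index_eq_bot hcl hc
  · rw [index_of_infinite_ker S hk]
    exact eventually_index_eq_top hk
  · exact hS.elim (fun h => absurd h.2 hk) fun h => absurd h hc

end Stability

/-! ### Removing a quasi-nilpotent summand -/

section Decompositions

variable {X : Type*} [NormedAddCommGroup X] [NormedSpace ℂ X]

/-- A summand on which `D` is bijective does not contribute to the index of `D` on `M ⊔ N`. -/
theorem index_restrict_eq_of_bijective {D : X →L[ℂ] X} {M N Q : Submodule ℂ X}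
    (hM : ∀ x ∈ M, D x ∈ M) (hN : ∀ x ∈ N, D x ∈ N) (hQ : ∀ x ∈ Q, D x ∈ Q)
    (hdisj : Disjoint M N) (hsup : M ⊔ N = Q) (hbij : Function.Bijective (D.restrict hN)) :
    index (D.restrict hM) = index (D.restrict hQ) := by
  have hinj : ∀ n ∈ N, D n = 0 → n = 0 := fun n hn h =>
    congrArg Subtype.val (hbij.1 (a₁ := ⟨n, hn⟩) (a₂ := 0) (Subtype.ext (by simpa using h)))
  have hsurj : ∀ n ∈ N, ∃ n' ∈ N, D n' = n := fun n hn => by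
    obtain ⟨n', h⟩ := hbij.2 ⟨n, hn⟩
    exact ⟨n', n'.2, congrArg Subtype.val h⟩
  have hzero : ∀ n ∈ N, n ∈ M → n = 0 := fun n hn hm => Submodule.disjoint_def.1 hdisj n hm hn
  have hdec : ∀ q : Q, ∃ m ∈ M, ∃ n ∈ N, m + n = q := fun q =>
    Submodule.mem_sup.1 (hsup.symm ▸ q.2)
  have hNQ : N ≤ Q := hsup ▸ le_sup_right
  have hMQ : M ≤ Q := hsup ▸ le_sup_left
  have h := rank_eq_of_intertwining (f := (D.restrict hM : M →ₗ[ℂ] M))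
    (g := (D.restrict hQ : Q →ₗ[ℂ] Q)) (Submodule.inclusion hMQ)
    (Submodule.inclusion_injective hMQ) (fun _ => rfl) ?_ ?_ ?_
  · rw [index, index, nullity, nullity, deficiency, deficiency]
    exact congrArg₂ (fun a b : ℕ∞ => ((a : ENNReal) : EReal) - ((b : ENNReal) : EReal)) h.1 h.2
  · intro q hq
    obtain ⟨m, hm, n, hn, hmn⟩ := hdec q
    have hq' : D m + D n = 0 := by
      rw [← map_add, hmn]; exact congrArg Subtype.val hq
    have hDn : D n = 0 := hzero _ (hN n hn) (by
      rw [eq_neg_of_add_eq_zero_right hq']; exact M.neg_mem (hM m hm))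
    refine ⟨⟨m, hm⟩, Subtype.ext ?_⟩
    rw [← hmn, hinj n hn hDn, add_zero]
    rfl
  · intro q
    obtain ⟨m, hm, n, hn, hmn⟩ := hdec q
    obtain ⟨n', hn', rfl⟩ := hsurj n hn
    exact ⟨⟨m, hm⟩, ⟨n', hNQ hn'⟩, Subtype.ext hmn.symm⟩
  · intro x q hx
    obtain ⟨m, hm, n, hn, hmn⟩ := hdec q
    have hx' : (x : X) = D m + D n := by
      rw [← map_add, hmn]; exact congrArg Subtype.val hx
    have hDn : D n = 0 := hzero _ (hN n hn) (by
      rw [eq_sub_of_add_eq' hx'.symm]; exact M.sub_mem x.2 (hM m hm))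
    refine ⟨⟨m, hm⟩, Subtype.ext ?_⟩
    rw [hDn, add_zero] at hx'
    exact hx'.symm

variable {T : X →L[ℂ] X}

theorem sub_smul_mem {M : Submodule ℂ X} (hM : IsClosedInvariant T M) (c : ℂ) :
    ∀ x ∈ M, (T - c • ContinuousLinearMap.id ℂ X) x ∈ M := fun x hx =>
  M.sub_mem (hM.mapsTo x hx) (M.smul_mem c hx)

theorem IsQuasinilpotent.bijective_sub_smul {N : Submodule ℂ X} {hN : IsClosedInvariant T N}
    (h : IsQuasinilpotent (restr T hN)) {c : ℂ} (hc : c ≠ 0) :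
    Function.Bijective ((T - c • ContinuousLinearMap.id ℂ X).restrict (sub_smul_mem hN c)) := by
  have hu : IsUnit (algebraMap ℂ (N →L[ℂ] N) c - restr T hN) := by
    by_contra hcon
    exact hc (h hcon)
  obtain ⟨u, hu⟩ := hu.neg
  have hval : (T - c • ContinuousLinearMap.id ℂ X).restrict (sub_smul_mem hN c) =
      (u : N →L[ℂ] N) := by
    rw [hu, neg_sub, Algebra.algebraMap_eq_smul_one]
    rfl
  rw [hval]
  exact (ContinuousLinearEquiv.ofUnit u).bijective

variable [CompleteSpace X]

theorem IsSemiFredholm.eventually_index_restrict_sub_smul {M : Submodule ℂ X}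
    {hM : IsClosedInvariant T M} (h : IsSemiFredholm (restr T hM)) :
    ∀ᶠ c in 𝓝 (0 : ℂ), index ((T - c • ContinuousLinearMap.id ℂ X).restrict (sub_smul_mem hM c)) =
      index (restr T hM) := by
  have : CompleteSpace M := hM.isClosed.completeSpace_coe
  have hcont : Continuous fun c : ℂ => restr T hM - c • ContinuousLinearMap.id ℂ M := by fun_prop
  have hlim : Tendsto (fun c : ℂ => restr T hM - c • ContinuousLinearMap.id ℂ M) (𝓝 0)
      (𝓝 (restr T hM)) := hcont.tendsto' 0 _ (by ext x; simp)
  exact hlim.eventually h.eventually_index_eq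

/-- Subtracting a small `c ≠ 0` preserves the indices on `M` and `M'` and makes the operator
bijective on `N` and `N'`, so both indices equal that of `T - c` on the common sum. -/
theorem index_restr_eq_of_sup_eq {M N M' N' : Submodule ℂ X}
    (hM : IsClosedInvariant T M) (hN : IsClosedInvariant T N)
    (hM' : IsClosedInvariant T M') (hN' : IsClosedInvariant T N')
    (hd : Disjoint M N) (hd' : Disjoint M' N') (hsup : M ⊔ N = M' ⊔ N')
    (hS : IsSemiFredholm (restr T hM)) (hS' : IsSemiFredholm (restr T hM'))
    (hq : IsQuasinilpotent (restr T hN)) (hq' : IsQuasinilpotent (restr T hN')) :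
    index (restr T hM) = index (restr T hM') := by
  have hev := (hS.eventually_index_restrict_sub_smul.and
    hS'.eventually_index_restrict_sub_smul).filter_mono (nhdsWithin_le_nhds (s := {0}ᶜ))
  obtain ⟨c, ⟨h, h'⟩, hc⟩ := (hev.and self_mem_nhdsWithin).exists
  have hQ : ∀ x ∈ M ⊔ N, (T - c • ContinuousLinearMap.id ℂ X) x ∈ M ⊔ N := by
    intro x hx
    obtain ⟨m, hm, n, hn, rfl⟩ := Submodule.mem_sup.1 hx
    rw [map_add]
    exact Submodule.add_mem_sup (sub_smul_mem hM c m hm) (sub_smul_mem hN c n hn)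
  rw [← h, ← h', index_restrict_eq_of_bijective _ _ hQ hd rfl (hq.bijective_sub_smul hc),
    index_restrict_eq_of_bijective _ _ hQ hd' hsup.symm (hq'.bijective_sub_smul hc)]

end Decompositions

end PseudoSemiBFredholm

theorem mainTheorem1 {X : Type*} [NormedAddCommGroup X] [NormedSpace ℂ X] [CompleteSpace X]
    (T : X →L[ℂ] X) :
    (∀ (M N M' N' : Submodule ℂ X)
        (hM : PseudoSemiBFredholm.IsClosedInvariant T M)
        (hN : PseudoSemiBFredholm.IsClosedInvariant T N)
        (hM' : PseudoSemiBFredholm.IsClosedInvariant T M')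
        (hN' : PseudoSemiBFredholm.IsClosedInvariant T N'),
        Disjoint M N → Disjoint M' N' → M ⊔ N = M' ⊔ N' →
        IsClosed ((M ⊔ N : Submodule ℂ X) : Set X) →
        PseudoSemiBFredholm.IsSemiFredholm (PseudoSemiBFredholm.restr T hM) →
        PseudoSemiBFredholm.IsSemiFredholm (PseudoSemiBFredholm.restr T hM') →
        PseudoSemiBFredholm.IsQuasinilpotent (PseudoSemiBFredholm.restr T hN) →
        PseudoSemiBFredholm.IsQuasinilpotent (PseudoSemiBFredholm.restr T hN') →
        PseudoSemiBFredholm.index (PseudoSemiBFredholm.restr T hM) =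
          PseudoSemiBFredholm.index (PseudoSemiBFredholm.restr T hM')) ∧
    (∀ hT : PseudoSemiBFredholm.IsPseudoSemiBFredholm T,
        (∃! κ : EReal, PseudoSemiBFredholm.IsIndexValue T κ) ∧
        ∀ (M N : Submodule ℂ X) (h : PseudoSemiBFredholm.Reduces T M N),
          PseudoSemiBFredholm.IsSemiFredholm (PseudoSemiBFredholm.restr T h.left) →
          PseudoSemiBFredholm.IsQuasinilpotent (PseudoSemiBFredholm.restr T h.right) →
          PseudoSemiBFredholm.pseudoIndex T hT =
            PseudoSemiBFredholm.index (PseudoSemiBFredholm.restr T h.left)) := by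
  have huniq : ∀ κ κ' : EReal, PseudoSemiBFredholm.IsIndexValue T κ →
      PseudoSemiBFredholm.IsIndexValue T κ' → κ = κ' := by
    rintro _ _ ⟨M, N, h, hS, hq, rfl⟩ ⟨M', N', h', hS', hq', rfl⟩
    exact PseudoSemiBFredholm.index_restr_eq_of_sup_eq _ _ _ _ h.isCompl.disjoint
      h'.isCompl.disjoint (h.isCompl.sup_eq_top.trans h'.isCompl.sup_eq_top.symm) hS hS' hq hq'
  refine ⟨fun M N M' N' hM hN hM' hN' hd hd' hsup _ hS hS' hq hq' =>
    PseudoSemiBFredholm.index_restr_eq_of_sup_eq hM hN hM' hN' hd hd' hsup hS hS' hq hq',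
    fun hT => ⟨?_, fun M N h hS hq => ?_⟩⟩
  · obtain ⟨κ, hκ⟩ := hT.exists_isIndexValue
    exact ⟨κ, hκ, fun κ' hκ' => huniq κ' κ hκ' hκ⟩
  · exact huniq _ _ hT.exists_isIndexValue.choose_spec ⟨M, N, h, hS, hq, rfl⟩
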